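/- Let $F$ be a free Lie ring over $\mathbb Z$ (on an arbitrary set of generators), let $R$ be a Lie ideal of $F$, let $U(F)$ be the universal enveloping algebra of $F$, and identify $F$ with its image under the natural map $F\to U(F)$ (which is injective). Let $\varpi(F)$ be the augmentation ideal of $U(F)$, that is, the two-sided ideal generated by $F$. Let $\gamma_1(F)=F$ and $\gamma_{k+1}(F)=[F,\gamma_k(F)]$ for $k\ge1$ be the lower central series. For $k\ge0$ define $$R(0)=R,\qquad R(k+1)=[R(k),F],$$ $$\mathfrak r(0)=U(F)R,\qquad \mathfrak r(k+1)=\varpi(F)\,\mathfrak r(k)+\mathfrak r(k)\,\varpi(F).$$ Then for every $n\ge1$, $$F\cap\bigl(\varpi^{n+1}(F)+\mathfrak r(n-1)\bigr)=\gamma_{n+1}(F)+R(n-1).$$ -/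

import Mathlib

namespace LieDimension

variable (K : Type*) [CommRing K] (L : Type*) [LieRing L] [LieAlgebra K L]

/-- The augmentation ideal `ϖ(L)` of the universal enveloping algebra `U(L)`: the two-sided ideal
generated by the image of `L`, viewed as a left ideal in order to form products, powers and sums. -/
noncomputable def augmentationIdeal : Ideal (UniversalEnvelopingAlgebra K L) :=
  TwoSidedIdeal.asIdeal (TwoSidedIdeal.span (Set.range (UniversalEnvelopingAlgebra.ι K (L := L))))

/-- The lower central series `γ₁(L) = L`, `γₙ₊₁(L) = [L, γₙ(L)]`, indexed from `1`.
(Mathlib's series starts at index `0`; the value at `0` here is `L` and is never used.) -/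
def gamma (n : ℕ) : LieIdeal K L := LieModule.lowerCentralSeries K L L (n - 1)

variable {K L}

/-- `R(0) = R` and `R(k+1) = [R(k), L]`. -/
def iterBracket (R : LieIdeal K L) : ℕ → LieIdeal K L
  | 0 => R
  | k + 1 => ⁅iterBracket R k, (⊤ : LieIdeal K L)⁆

/-- `𝔯(0) = U(L) R`, the left ideal generated by the image of `R` (it is two-sided because `R` is a
Lie ideal), and `𝔯(k+1) = ϖ(L) 𝔯(k) + 𝔯(k) ϖ(L)`. -/
noncomputable def iterIdeal (R : LieIdeal K L) : ℕ → Ideal (UniversalEnvelopingAlgebra K L)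
  | 0 => Ideal.span (UniversalEnvelopingAlgebra.ι K '' (R : Set L))
  | k + 1 => augmentationIdeal K L * iterIdeal R k + iterIdeal R k * augmentationIdeal K L

end LieDimension

/- The free Lie ring carries two (propositionally equal) `LieAlgebra ℤ` structures in Mathlib; the
statement uses the one that belongs to `FreeLieAlgebra`. -/
attribute [local instance 1100] FreeLieAlgebra.instLieAlgebra

namespace LieDimension

/-! ### Lexicographic order on words -/

section Words

variable {X : Type*} [LinearOrder X]

theorem append_lt_append_iff_right' (u : List X) {v w : List X} : u ++ v < u ++ w ↔ v < w := by
  induction u with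
  | nil => rfl
  | cons x u ih => simp [ih]

theorem lt_append_of_ne_nil (u : List X) {v : List X} (hv : v ≠ []) : u < u ++ v := by
  obtain ⟨x, v, rfl⟩ := List.exists_cons_of_ne_nil hv
  conv_lhs => rw [← List.append_nil u]
  exact (append_lt_append_iff_right' u).2 (List.nil_lt_cons x v)

theorem prefix_or_append_lt_append {u v : List X} (h : u < v) :
    u <+: v ∨ ∀ x y : List X, u ++ x < v ++ y := by
  induction u generalizing v with
  | nil => exact Or.inl List.nil_prefix
  | cons a u ih =>
    cases v with
    | nil => exact absurd h (List.not_lt_nil _)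
    | cons b v =>
      rcases List.cons_lt_cons_iff.1 h with hab | ⟨rfl, huv⟩
      · exact Or.inr fun x y => List.cons_lt_cons_iff.2 (Or.inl hab)
      · rcases ih huv with hp | hs
        · exact Or.inl ((List.prefix_cons_inj a).2 hp)
        · exact Or.inr fun x y => List.cons_lt_cons_iff.2 (Or.inr ⟨rfl, hs x y⟩)

theorem append_lt_append_of_length_le {u v : List X} (h : u < v) (hl : v.length ≤ u.length)
    (x y : List X) : u ++ x < v ++ y := by
  rcases prefix_or_append_lt_append h with hp | hs
  · exact absurd (hp.eq_of_length_le hl) h.ne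
  · exact hs x y

/-- A word that is smaller than each of its proper nonempty suffixes. -/
def IsLyndon (u : List X) : Prop := ∀ p s : List X, p ≠ [] → s ≠ [] → u = p ++ s → u < s

theorem IsLyndon.append_lt {u v : List X} (hv : IsLyndon v) (hu : u ≠ [])
    (h : u < v) : u ++ v < v := by
  rcases prefix_or_append_lt_append h with ⟨w, rfl⟩ | hs
  · have hw : w ≠ [] := by rintro rfl; simp at h
    exact (append_lt_append_iff_right' u).2 (hv u w hu hw rfl)
  · simpa using hs v []

theorem IsLyndon.append {u v : List X} (hu : IsLyndon u) (hv : IsLyndon v) (hu0 : u ≠ [])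
    (hv0 : v ≠ []) (h : u < v) : IsLyndon (u ++ v) := by
  intro p s hp hs he
  have huv := hv.append_lt hu0 h
  rcases List.append_eq_append_iff.1 he with ⟨a, rfl, rfl⟩ | ⟨c, rfl, rfl⟩
  · rcases eq_or_ne a [] with rfl | ha
    · simpa using huv
    · exact huv.trans (hv a s ha hs rfl)
  · rcases eq_or_ne c [] with rfl | hc
    · simpa using huv
    · exact append_lt_append_of_length_le (hu p c hp hc rfl) (by simp) v v

end Words

/-! ### Standard bracketings of Lyndon words -/

/-- Formal iterated brackets of letters. -/
inductive Bracketing (X : Type*)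
  | leaf : X → Bracketing X
  | node : Bracketing X → Bracketing X → Bracketing X

namespace Bracketing

variable {X : Type*}

/-- The word of letters of a bracketing. -/
def foliage : Bracketing X → List X
  | leaf x => [x]
  | node a b => foliage a ++ foliage b

theorem foliage_ne_nil (t : Bracketing X) : t.foliage ≠ [] := by
  induction t with
  | leaf x => simp [foliage]
  | node a b ha _ => simp [foliage, ha]

/-- The value of a bracketing in a Lie ring, for given values of the letters. -/
def eval {L : Type*} [LieRing L] (f : X → L) : Bracketing X → L
  | leaf x => f x
  | node a b => ⁅eval f a, eval f b⁆

theorem map_eval {K L L' : Type*} [CommRing K] [LieRing L] [LieAlgebra K L] [LieRing L']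
    [LieAlgebra K L'] (φ : L →ₗ⁅K⁆ L') (f : X → L) (t : Bracketing X) :
    φ (t.eval f) = t.eval (φ ∘ f) := by
  induction t with
  | leaf x => rfl
  | node a b ha hb => simp only [eval, LieHom.map_lie, ha, hb]

variable [LinearOrder X]

/-- Either a letter, or a bracket whose right factor is at least the word `v`. -/
def RightGE (v : List X) : Bracketing X → Prop
  | leaf _ => True
  | node _ d => v ≤ d.foliage

/-- The standard bracketings of Lyndon words. -/
def IsStandard : Bracketing X → Prop
  | leaf _ => True
  | node a b => IsStandard a ∧ IsStandard b ∧ a.foliage < b.foliage ∧ RightGE b.foliage a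

theorem IsStandard.isLyndon {t : Bracketing X} (h : t.IsStandard) : IsLyndon t.foliage := by
  induction t with
  | leaf x =>
    intro p s hp hs he
    have := congrArg List.length he
    have := List.length_pos_of_ne_nil hp
    have := List.length_pos_of_ne_nil hs
    simp [foliage] at *
    omega
  | node a b iha ihb =>
    obtain ⟨ha, hb, hab, -⟩ := h
    exact (iha ha).append (ihb hb) a.foliage_ne_nil b.foliage_ne_nil hab

theorem IsStandard.foliage_lt_right {a b : Bracketing X} (h : (node a b).IsStandard) :
    (node a b).foliage < b.foliage :=
  h.2.1.isLyndon.append_lt a.foliage_ne_nil h.2.2.1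

theorem IsStandard.right_le_of_suffix {a b : Bracketing X} (h : (node a b).IsStandard)
    {p s : List X} (hp : p ≠ []) (hs : s ≠ []) (he : (node a b).foliage = p ++ s) :
    b.foliage ≤ s := by
  induction a generalizing b p s with
  | leaf x =>
    rcases List.append_eq_append_iff.1 he with ⟨c, -, hc⟩ | ⟨c, hc, rfl⟩
    · rcases eq_or_ne c [] with rfl | hc0
      · simp [hc]
      · exact (h.2.1.isLyndon c s hc0 hs hc).le
    · have : c = [] := by
        have h1 := congrArg List.length hc
        have h2 := List.length_pos_of_ne_nil hp
        simp [foliage] at h1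
        exact List.length_eq_zero_iff.1 (by omega)
      simp [this]
  | node c d ihc _ =>
    rcases List.append_eq_append_iff.1 he with ⟨e, -, he'⟩ | ⟨e, he', rfl⟩
    · rcases eq_or_ne e [] with rfl | he0
      · simp [he']
      · exact (h.2.1.isLyndon e s he0 hs he').le
    · rcases eq_or_ne e [] with rfl | he0
      · simp
      · exact (h.2.2.2.trans (ihc h.1 hp he0 he')).trans
          (lt_append_of_ne_nil e b.foliage_ne_nil).le

theorem IsStandard.eq_of_foliage_eq {a b : Bracketing X} (ha : a.IsStandard) (hb : b.IsStandard)
    (h : a.foliage = b.foliage) : a = b := by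
  induction a generalizing b with
  | leaf x =>
    cases b with
    | leaf y => simpa [foliage] using h
    | node c d =>
      have h1 := congrArg List.length h
      have h2 := List.length_pos_of_ne_nil c.foliage_ne_nil
      have h3 := List.length_pos_of_ne_nil d.foliage_ne_nil
      simp [foliage] at h1
      omega
  | node a₁ a₂ ih₁ ih₂ =>
    cases b with
    | leaf y =>
      have h1 := congrArg List.length h
      have h2 := List.length_pos_of_ne_nil a₁.foliage_ne_nil
      have h3 := List.length_pos_of_ne_nil a₂.foliage_ne_nil
      simp [foliage] at h1
      omega
    | node b₁ b₂ =>
      have h2 : a₂.foliage = b₂.foliage := le_antisymm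
        (ha.right_le_of_suffix b₁.foliage_ne_nil b₂.foliage_ne_nil h)
        (hb.right_le_of_suffix a₁.foliage_ne_nil a₂.foliage_ne_nil h.symm)
      have h1 : a₁.foliage = b₁.foliage := by
        simp only [foliage, h2] at h
        exact List.append_cancel_right h
      rw [ih₁ ha.1 hb.1 h1, ih₂ ha.2.1 hb.2.1 h2]

end Bracketing
namespace Bracketing

/-! ### Standard bracketings span -/

section Span

variable {X : Type*} (K : Type*) {L : Type*} [CommRing K] [LieRing L]
  [LieAlgebra K L]

theorem finite_subperm (w : List X) : {v : List X | v.Subperm w}.Finite := by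
  refine ((w.sublists.flatMap List.permutations).finite_toSet).subset fun v hv => ?_
  obtain ⟨l, hl, hlw⟩ := hv
  exact List.mem_flatMap.2 ⟨l, List.mem_sublists.2 hlw, List.mem_permutations.2 hl.symm⟩

variable [LinearOrder X]

/-- The span of the standard brackets with content `w` and right factor at most `v`. -/
def standardSpan (f : X → L) (w v : List X) : Submodule K L :=
  Submodule.span K (eval f '' {t | t.IsStandard ∧ t.foliage.Perm w ∧
    ∃ c d, t = node c d ∧ d.foliage ≤ v})

variable {K}

theorem standardSpan_mono (f : X → L) {w w' v v' : List X} (hw : w.Perm w') (hv : v ≤ v') :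
    standardSpan K f w v ≤ standardSpan K f w' v' := by
  refine Submodule.span_mono (Set.image_mono ?_)
  rintro t ⟨ht, hp, c, d, h, hd⟩
  exact ⟨ht, hp.trans hw, c, d, h, hd.trans hv⟩

variable (K)

theorem lie_eval_mem_standardSpan (f : X → L) (a b : Bracketing X) (ha : a.IsStandard)
    (hb : b.IsStandard) (hab : a.foliage < b.foliage) :
    ⁅a.eval f, b.eval f⁆ ∈ standardSpan K f (a.foliage ++ b.foliage) b.foliage := by
  induction hn : (a.foliage ++ b.foliage).length using Nat.strong_induction_on
    generalizing a b with | _ n ihn =>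
  obtain ⟨w, hw⟩ : ∃ w, w = a.foliage ++ b.foliage := ⟨_, rfl⟩
  suffices H : ∀ v, v.Subperm w → ∀ a b : Bracketing X, a.IsStandard → b.IsStandard →
      a.foliage < b.foliage → (a.foliage ++ b.foliage).Perm w → b.foliage = v →
      ⁅a.eval f, b.eval f⁆ ∈ standardSpan K f w v by
    subst hw
    exact H _ (List.sublist_append_right _ _).subperm a b ha hb hab (List.Perm.refl _) rfl
  replace hn : w.length = n := by rw [hw, hn]
  clear hab ha hb hw a b
  intro v hv
  refine ((finite_subperm w).wellFoundedOn (r := (· < ·))).induction hv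
    (P := fun v => ∀ a b : Bracketing X, a.IsStandard → b.IsStandard →
      a.foliage < b.foliage → (a.foliage ++ b.foliage).Perm w → b.foliage = v →
      ⁅a.eval f, b.eval f⁆ ∈ standardSpan K f w v) ?_
  rintro v - ihv a b ha hb hab hw rfl
  have base : RightGE b.foliage a → ⁅a.eval f, b.eval f⁆ ∈ standardSpan K f w b.foliage :=
    fun h => Submodule.subset_span ⟨node a b, ⟨⟨ha, hb, hab, h⟩, hw, a, b, rfl, le_rfl⟩, rfl⟩
  have subw : ∀ x y : Bracketing X, (x.foliage ++ y.foliage).Perm w → y.foliage.Subperm w :=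
    fun x y h => (List.sublist_append_right _ _).subperm.trans h.subperm
  have aux : ∀ x y : Bracketing X, x.IsStandard → y.IsStandard → x.foliage < b.foliage →
      y.foliage < b.foliage → (x.foliage ++ y.foliage).Perm w →
      ⁅x.eval f, y.eval f⁆ ∈ standardSpan K f w b.foliage := by
    intro x y hx hy hxb hyb hxy
    rcases lt_trichotomy x.foliage y.foliage with h | h | h
    · exact standardSpan_mono f (List.Perm.refl _) hyb.le
        (ihv _ (subw x y hxy) hyb x y hx hy h hxy rfl)
    · rw [hx.eq_of_foliage_eq hy h, lie_self]
      exact zero_mem _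
    · rw [← lie_skew]
      have hyx := List.perm_append_comm.trans hxy
      exact neg_mem (standardSpan_mono f (List.Perm.refl _) hxb.le
        (ihv _ (subw y x hyx) hxb y x hy hx h hyx rfl))
  cases a with
  | leaf x => exact base trivial
  | node c d =>
    by_cases hbd : b.foliage ≤ d.foliage
    · exact base hbd
    rw [not_le] at hbd
    have hc := ha.1
    have hd := ha.2.1
    have hcb : c.foliage < b.foliage := ha.2.2.1.trans hbd
    have hlen := hw.length_eq
    have hc0 := List.length_pos_of_ne_nil c.foliage_ne_nil
    have hd0 := List.length_pos_of_ne_nil d.foliage_ne_nil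
    simp only [foliage, List.length_append] at hlen
    have hlb : ∀ k : Bracketing X, k.IsStandard → (∃ k₁ k₂, k = node k₁ k₂ ∧
        k₂.foliage ≤ b.foliage) → k.foliage < b.foliage := by
      rintro _ hk ⟨k₁, k₂, rfl, hk₂⟩
      exact hk.foliage_lt_right.trans_le hk₂
    have h1 : ⁅c.eval f, ⁅d.eval f, b.eval f⁆⁆ ∈ standardSpan K f w b.foliage := by
      have := ihn _ (by simp only [List.length_append]; omega) d b hd hb hbd rfl
      refine Submodule.span_induction (p := fun z _ => ⁅c.eval f, z⁆ ∈ standardSpan K f w b.foliage)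
        ?_ (by simp) (fun x y _ _ hx hy => by rw [lie_add]; exact add_mem hx hy)
        (fun r x _ hx => by rw [lie_smul]; exact Submodule.smul_mem _ _ hx) this
      rintro _ ⟨k, ⟨hk, hkp, hkr⟩, rfl⟩
      refine aux c k hc hk hcb (hlb k hk hkr) ((hkp.append_left _).trans ?_)
      simpa [foliage] using hw
    have h2 : ⁅⁅c.eval f, b.eval f⁆, d.eval f⁆ ∈ standardSpan K f w b.foliage := by
      have := ihn _ (by simp only [List.length_append]; omega) c b hc hb hcb rfl
      refine Submodule.span_induction (p := fun z _ => ⁅z, d.eval f⁆ ∈ standardSpan K f w b.foliage)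
        ?_ (by simp) (fun x y _ _ hx hy => by rw [add_lie]; exact add_mem hx hy)
        (fun r x _ hx => by rw [smul_lie]; exact Submodule.smul_mem _ _ hx) this
      rintro _ ⟨k, ⟨hk, hkp, hkr⟩, rfl⟩
      refine aux k d hk hd (hlb k hk hkr) hbd ((hkp.append_right _).trans (List.Perm.trans ?_ hw))
      simpa [foliage] using List.perm_append_comm.append_left c.foliage
    have : ⁅(node c d).eval f, b.eval f⁆ =
        ⁅c.eval f, ⁅d.eval f, b.eval f⁆⁆ + ⁅⁅c.eval f, b.eval f⁆, d.eval f⁆ := by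
      rw [eval, lie_lie, ← lie_skew (d.eval f) ⁅c.eval f, b.eval f⁆, sub_neg_eq_add]
    rw [this]
    exact add_mem h1 h2

theorem lie_mem_span_eval (f : X → L) {x y : L}
    (hx : x ∈ Submodule.span K (eval f '' {t | t.IsStandard}))
    (hy : y ∈ Submodule.span K (eval f '' {t | t.IsStandard})) :
    ⁅x, y⁆ ∈ Submodule.span K (eval f '' {t | t.IsStandard}) := by
  have key : ∀ a b : Bracketing X, a.IsStandard → b.IsStandard → a.foliage < b.foliage →
      ⁅a.eval f, b.eval f⁆ ∈ Submodule.span K (eval f '' {t | t.IsStandard}) :=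
    fun a b ha hb hab => Submodule.span_mono (Set.image_mono fun t ht => ht.1)
      (lie_eval_mem_standardSpan K f a b ha hb hab)
  induction hx, hy using Submodule.span_induction₂ with
  | mem_mem x y hx hy =>
    obtain ⟨a, ha, rfl⟩ := hx
    obtain ⟨b, hb, rfl⟩ := hy
    rcases lt_trichotomy a.foliage b.foliage with h | h | h
    · exact key a b ha hb h
    · rw [ha.eq_of_foliage_eq hb h, lie_self]
      exact zero_mem _
    · rw [← lie_skew]
      exact neg_mem (key b a hb ha h)
  | zero_left y hy => simp
  | zero_right x hx => simp
  | add_left x y z _ _ _ hx hy => rw [add_lie]; exact add_mem hx hy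
  | add_right x y z _ _ _ hx hy => rw [lie_add]; exact add_mem hx hy
  | smul_left r x y _ _ h => rw [smul_lie]; exact Submodule.smul_mem _ _ h
  | smul_right r x y _ _ h => rw [lie_smul]; exact Submodule.smul_mem _ _ h

end Span

end Bracketing

theorem lieSubalgebra_eq_top_of_of_mem {K X : Type*} [CommRing K]
    (S : LieSubalgebra K (FreeLieAlgebra K X)) (h : ∀ x, FreeLieAlgebra.of K x ∈ S) : S = ⊤ := by
  let g : FreeLieAlgebra K X →ₗ⁅K⁆ S :=
    FreeLieAlgebra.lift K fun x => (⟨FreeLieAlgebra.of K x, h x⟩ : S)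
  have hg : S.incl.comp g = LieHom.id := by
    ext x
    simp [g]
  refine eq_top_iff.2 fun y _ => ?_
  have := congrArg (fun φ => φ y) hg
  simp only [LieHom.comp_apply, LieHom.id_apply] at this
  rw [← this]
  exact (g y).2

theorem Bracketing.span_eval_of_eq_top (K X : Type*) [CommRing K] [LinearOrder X] :
    Submodule.span K (eval (FreeLieAlgebra.of K) '' {t : Bracketing X | t.IsStandard}) = ⊤ := by
  let S : LieSubalgebra K (FreeLieAlgebra K X) :=
    { Submodule.span K (eval (FreeLieAlgebra.of K) '' {t : Bracketing X | t.IsStandard}) with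
      lie_mem' := lie_mem_span_eval K _ }
  have hS : S = ⊤ := lieSubalgebra_eq_top_of_of_mem S fun x =>
    Submodule.subset_span ⟨leaf x, trivial, rfl⟩
  simpa [S] using congrArg LieSubalgebra.toSubmodule hS

attribute [local instance 100] LieRing.ofAssociativeRing

/-! ### Triangularity in the free associative algebra -/

section Triangular

variable (K : Type*) [CommRing K] {X : Type*}

/-- A word, as an element of the free associative algebra. -/
noncomputable def word (w : List X) : MonoidAlgebra K (FreeMonoid X) :=
  MonoidAlgebra.single (FreeMonoid.ofList w) 1

theorem word_mul_word (v w : List X) : word K v * word K w = word K (v ++ w) := by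
  simp [word]

/-- The span of a set of words. -/
noncomputable def wordSpan (S : Set (List X)) : Submodule K (MonoidAlgebra K (FreeMonoid X)) :=
  Submodule.span K (word K '' S)

variable {K}

theorem wordSpan_mono {S T : Set (List X)} (h : S ⊆ T) : wordSpan K S ≤ wordSpan K T :=
  Submodule.span_mono (Set.image_mono h)

theorem word_mem_wordSpan {S : Set (List X)} {w : List X} (h : w ∈ S) : word K w ∈ wordSpan K S :=
  Submodule.subset_span ⟨w, h, rfl⟩

theorem mul_mem_wordSpan {S T U : Set (List X)} (h : ∀ s ∈ S, ∀ t ∈ T, s ++ t ∈ U)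
    {x y : MonoidAlgebra K (FreeMonoid X)} (hx : x ∈ wordSpan K S) (hy : y ∈ wordSpan K T) :
    x * y ∈ wordSpan K U := by
  have := Submodule.mul_mem_mul hx hy
  rw [wordSpan, wordSpan, Submodule.span_mul_span] at this
  refine Submodule.span_mono ?_ this
  rintro _ ⟨_, ⟨s, hs, rfl⟩, _, ⟨t, ht, rfl⟩, rfl⟩
  exact ⟨s ++ t, h s hs t ht, (word_mul_word K s t).symm⟩

theorem coeff_eq_zero_of_mem_wordSpan {S : Set (List X)} {x : MonoidAlgebra K (FreeMonoid X)}
    (hx : x ∈ wordSpan K S) {w : List X} (hw : w ∉ S) : x.coeff (FreeMonoid.ofList w) = 0 := by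
  induction hx using Submodule.span_induction with
  | mem x hx =>
    obtain ⟨v, hv, rfl⟩ := hx
    have : v ≠ w := by rintro rfl; exact hw hv
    simp [word, this]
  | zero => simp
  | add x y _ _ hx hy => simp [hx, hy]
  | smul r x _ hx => simp [hx]

variable [LinearOrder X]

theorem eval_sub_word_mem_wordSpan {t : Bracketing X} (ht : t.IsStandard) :
    t.eval (fun x => word K [x]) - word K t.foliage ∈
      wordSpan K {v | v.Perm t.foliage ∧ t.foliage < v} := by
  induction t with
  | leaf x => simp [Bracketing.eval, Bracketing.foliage]
  | node a b iha ihb =>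
    have ha := iha ht.1
    have hb := ihb ht.2.1
    have weak : ∀ {c : Bracketing X}, c.eval (fun x => word K [x]) - word K c.foliage ∈
        wordSpan K {v | v.Perm c.foliage ∧ c.foliage < v} →
        c.eval (fun x => word K [x]) ∈ wordSpan K {v | v.Perm c.foliage ∧ c.foliage ≤ v} := by
      intro c hc
      rw [← sub_add_cancel (c.eval fun x => word K [x]) (word K c.foliage)]
      have hm : wordSpan K {v | v.Perm c.foliage ∧ c.foliage < v} ≤
          wordSpan K {v | v.Perm c.foliage ∧ c.foliage ≤ v} :=
        wordSpan_mono fun v hv => ⟨hv.1, hv.2.le⟩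
      have hw : c.foliage ∈ {v | v.Perm c.foliage ∧ c.foliage ≤ v} := ⟨List.Perm.refl _, le_rfl⟩
      exact add_mem (hm hc) (word_mem_wordSpan hw)
    have hle : ∀ {u v u' v' : List X}, u'.Perm u → u ≤ u' → v ≤ v' → u ++ v ≤ u' ++ v' := by
      intro u v u' v' hp hu hv
      rcases hu.lt_or_eq with h | rfl
      · exact (append_lt_append_of_length_le h hp.length_eq.le _ _).le
      · rcases hv.lt_or_eq with h | rfl
        · exact ((append_lt_append_iff_right' u).2 h).le
        · exact le_rfl
    have h1 := mul_mem_wordSpan (K := K)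
      (S := {v | v.Perm a.foliage ∧ a.foliage < v}) (T := {v | v.Perm b.foliage ∧ b.foliage ≤ v})
      (U := {v | v.Perm (Bracketing.node a b).foliage ∧
        (Bracketing.node a b).foliage < v}) (fun s hs t ht => ⟨hs.1.append ht.1,
        append_lt_append_of_length_le hs.2 hs.1.length_eq.le _ _⟩) ha (weak hb)
    have h2 := mul_mem_wordSpan (K := K) (S := {a.foliage})
      (T := {v | v.Perm b.foliage ∧ b.foliage < v})
      (U := {v | v.Perm (Bracketing.node a b).foliage ∧
        (Bracketing.node a b).foliage < v}) (fun s hs t ht => by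
        rw [Set.mem_singleton_iff.1 hs]
        exact ⟨ht.1.append_left _, (append_lt_append_iff_right' _).2 ht.2⟩)
        (word_mem_wordSpan rfl) hb
    have h3 := mul_mem_wordSpan (K := K)
      (S := {v | v.Perm b.foliage ∧ b.foliage ≤ v}) (T := {v | v.Perm a.foliage ∧ a.foliage ≤ v})
      (U := {v | v.Perm (Bracketing.node a b).foliage ∧
        (Bracketing.node a b).foliage < v}) (fun s hs t ht' => ⟨(hs.1.append ht'.1).trans
        List.perm_append_comm, (ht.foliage_lt_right.trans
          (lt_append_of_ne_nil _ a.foliage_ne_nil)).trans_le (hle hs.1 hs.2 ht'.2)⟩)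
        (weak hb) (weak ha)
    have : (Bracketing.node a b).eval (fun x => word K [x]) - word K (Bracketing.node a b).foliage =
        (a.eval (fun x => word K [x]) - word K a.foliage) * b.eval (fun x => word K [x]) +
        word K a.foliage * (b.eval (fun x => word K [x]) - word K b.foliage) -
        b.eval (fun x => word K [x]) * a.eval (fun x => word K [x]) := by
      rw [Bracketing.eval, Bracketing.foliage, LieRing.of_associative_ring_bracket, mul_sub,
        word_mul_word, sub_mul]
      abel
    rw [this]
    exact sub_mem (add_mem h1 h2) h3

theorem coeff_eval_foliage {t : Bracketing X} (ht : t.IsStandard) :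
    (t.eval fun x => word K [x]).coeff (FreeMonoid.ofList t.foliage) = 1 := by
  have := coeff_eq_zero_of_mem_wordSpan (eval_sub_word_mem_wordSpan (K := K) ht)
    (w := t.foliage) (by simp)
  rw [MonoidAlgebra.coeff_sub, Finsupp.sub_apply, sub_eq_zero] at this
  rw [this]
  simp [word]

theorem perm_and_le_of_coeff_eval_ne_zero {t : Bracketing X} (ht : t.IsStandard) {w : List X}
    (hw : (t.eval fun x => word K [x]).coeff (FreeMonoid.ofList w) ≠ 0) :
    w.Perm t.foliage ∧ t.foliage ≤ w := by
  by_contra h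
  refine hw ?_
  have := coeff_eq_zero_of_mem_wordSpan (eval_sub_word_mem_wordSpan (K := K) ht) (w := w)
    fun hv => h ⟨hv.1, hv.2.le⟩
  rw [MonoidAlgebra.coeff_sub, Finsupp.sub_apply, sub_eq_zero] at this
  have hne : t.foliage ≠ w := by rintro rfl; exact h ⟨List.Perm.refl _, le_rfl⟩
  rw [this]
  simp [word, hne]

variable (K X) in
/-- The canonical map from the free Lie algebra to the free associative algebra. -/
noncomputable def toWords : FreeLieAlgebra K X →ₗ⁅K⁆ MonoidAlgebra K (FreeMonoid X) :=
  FreeLieAlgebra.lift K fun x => word K [x]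

omit [LinearOrder X] in
theorem toWords_eval (t : Bracketing X) :
    toWords K X (t.eval (FreeLieAlgebra.of K)) = t.eval fun x => word K [x] := by
  rw [Bracketing.map_eval]
  congr 1
  exact FreeLieAlgebra.of_comp_lift _

/-- If the coefficients of the image of a Lie element in the free associative algebra satisfy
congruence conditions invariant under permuting letters, then so do its coordinates with respect to
the Lyndon basis. -/
theorem mem_span_smul_eval (M : List X → Ideal K) (hM : ∀ v w : List X, v.Perm w → M v = M w)
    (y : FreeLieAlgebra K X)
    (hy : ∀ w, (toWords K X y).coeff (FreeMonoid.ofList w) ∈ M w) :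
    y ∈ Submodule.span K {z | ∃ t : Bracketing X, t.IsStandard ∧
      ∃ c ∈ M t.foliage, z = c • t.eval (FreeLieAlgebra.of K)} := by
  classical
  have hspan : y ∈ Submodule.span K
      (Bracketing.eval (FreeLieAlgebra.of K) '' {t : Bracketing X | t.IsStandard}) := by
    rw [Bracketing.span_eval_of_eq_top]; trivial
  obtain ⟨c, hc, rfl⟩ := (Finsupp.mem_span_image_iff_linearCombination K).1 hspan
  have hstd : ∀ t ∈ c.support, t.IsStandard := fun t ht => hc ht
  have key : ∀ t ∈ c.support, c t ∈ M t.foliage := by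
    by_contra! hbad
    obtain ⟨t₀, ht₀, hbad₀⟩ := hbad
    obtain ⟨t, ht, hmin⟩ := (c.support.filter fun t => c t ∉ M t.foliage).exists_min_image
      Bracketing.foliage ⟨t₀, Finset.mem_filter.2 ⟨ht₀, hbad₀⟩⟩
    obtain ⟨ht, hct⟩ := Finset.mem_filter.1 ht
    refine hct ?_
    have h := hy t.foliage
    rw [Finsupp.linearCombination_apply, Finsupp.sum, map_sum, MonoidAlgebra.coeff_sum,
      Finset.sum_apply', ← Finset.add_sum_erase _ _ ht] at h
    simp only [map_smul, toWords_eval, MonoidAlgebra.coeff_smul, Finsupp.smul_apply,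
      coeff_eval_foliage (hstd t ht), smul_eq_mul, mul_one] at h
    refine (Ideal.add_mem_iff_left _ (Ideal.sum_mem _ fun s hs => ?_)).1 h
    obtain ⟨hst, hs⟩ := Finset.mem_erase.1 hs
    by_cases h0 : (s.eval fun x => word K [x]).coeff (FreeMonoid.ofList t.foliage) = 0
    · simp [h0]
    obtain ⟨hp, hle⟩ := perm_and_le_of_coeff_eval_ne_zero (hstd s hs) h0
    have hlt : s.foliage < t.foliage :=
      hle.lt_of_ne fun he => hst ((hstd s hs).eq_of_foliage_eq (hstd t ht) he)
    refine Ideal.mul_mem_right _ _ ?_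
    rw [hM _ _ hp]
    by_contra hcs
    exact (hmin s (Finset.mem_filter.2 ⟨hs, hcs⟩)).not_gt hlt
  rw [Finsupp.linearCombination_apply]
  exact Submodule.sum_mem _ fun t ht => Submodule.subset_span ⟨t, hstd t ht, c t, key t ht, rfl⟩

end Triangular

/-! ### Elements of the free associative algebra with coefficients in prescribed ideals -/

section Coefficients

variable {K X : Type*} [CommRing K]

/-- The elements of the free associative algebra whose coefficient at `w` lies in `M w`. -/
def coeffsIn (M : List X → Ideal K) : Submodule K (MonoidAlgebra K (FreeMonoid X)) where
  carrier := {a | ∀ w, a.coeff (FreeMonoid.ofList w) ∈ M w}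
  zero_mem' w := by simp
  add_mem' ha hb w := by
    rw [MonoidAlgebra.coeff_add, Finsupp.add_apply]
    exact add_mem (ha w) (hb w)
  smul_mem' c a ha w := by
    rw [MonoidAlgebra.coeff_smul, Finsupp.smul_apply]
    exact Ideal.mul_mem_left _ c (ha w)

theorem coeffsIn_mono {M M' : List X → Ideal K} (h : ∀ w, M w ≤ M' w) :
    coeffsIn M ≤ coeffsIn M' :=
  fun _ ha w => h w (ha w)

theorem mul_mem_coeffsIn {M M' M'' : List X → Ideal K} (h : ∀ u v, M u * M' v ≤ M'' (u ++ v))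
    {a b : MonoidAlgebra K (FreeMonoid X)} (ha : a ∈ coeffsIn M) (hb : b ∈ coeffsIn M') :
    a * b ∈ coeffsIn M'' := by
  classical
  intro w
  rw [MonoidAlgebra.coeff_mul]
  refine Ideal.sum_mem _ fun u _ => Ideal.sum_mem _ fun v _ => ?_
  dsimp only
  split_ifs with huv
  · have : u.toList ++ v.toList = w := congrArg FreeMonoid.toList huv
    rw [← this]
    exact h _ _ (Ideal.mul_mem_mul (ha _) (hb _))
  · exact zero_mem _

theorem word_mem_coeffsIn {M : List X → Ideal K} {w : List X} {c : K} (h : c ∈ M w) :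
    c • word K w ∈ coeffsIn M := by
  classical
  intro v
  by_cases hv : w = v
  · subst hv; simpa [word] using h
  · simp [word, hv]

/-- The condition on coefficients that all words have length at least `k`. -/
def lengthGE (K : Type*) [CommRing K] {X : Type*} (k : ℕ) (w : List X) : Ideal K :=
  if w.length < k then ⊥ else ⊤

/-- The condition on coefficients that all words have length at least `k` and that those words of
length exactly `k` have coefficients in the ideal generated by the values of `m` at the letters. -/
def modulus (m : X → K) (k : ℕ) (w : List X) : Ideal K :=
  if w.length < k then ⊥ else if w.length = k then Ideal.span (m '' {x | x ∈ w}) else ⊤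

theorem modulus_perm (m : X → K) (k : ℕ) {v w : List X} (h : v.Perm w) :
    modulus m k v = modulus m k w := by
  simp only [modulus, h.length_eq, h.mem_iff]

theorem lengthGE_le_modulus (m : X → K) (k : ℕ) (w : List X) :
    lengthGE K (k + 1) w ≤ modulus m k w := by
  unfold lengthGE modulus
  split_ifs <;> first | omega | simp

theorem lengthGE_mul_le (i j : ℕ) (u v : List X) :
    lengthGE K i u * lengthGE K j v ≤ lengthGE K (i + j) (u ++ v) := by
  unfold lengthGE
  rw [List.length_append]
  split_ifs <;> first | omega | simp

theorem lengthGE_mul_modulus_le (m : X → K) (i j : ℕ) (u v : List X) :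
    lengthGE K i u * modulus m j v ≤ modulus m (i + j) (u ++ v) := by
  unfold lengthGE modulus
  rw [List.length_append]
  split_ifs <;> first
    | omega
    | simp only [Ideal.bot_mul, Ideal.mul_bot, bot_le, le_top]
    | skip
  refine Ideal.mul_le_right.trans (Ideal.span_mono (Set.image_mono fun x hx => ?_))
  exact List.mem_append_right _ hx

theorem modulus_mul_lengthGE_le (m : X → K) (i j : ℕ) (u v : List X) :
    modulus m i u * lengthGE K j v ≤ modulus m (i + j) (u ++ v) := by
  rw [modulus_perm m _ (List.perm_append_comm (l₁ := u) (l₂ := v)), mul_comm, add_comm]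
  exact lengthGE_mul_modulus_le m j i v u

end Coefficients

/-! ### Adapted bases -/

theorem exists_basis_adapted_of_finite {K M ι : Type*} [CommRing K] [IsDomain K]
    [IsPrincipalIdealRing K] [AddCommGroup M] [Module K M] [Finite ι] (b : Module.Basis ι K M)
    (N : Submodule K M) :
    ∃ (e : Module.Basis ι K M) (m : ι → K),
      (∀ s ∈ N, ∀ i, m i ∣ e.repr s i) ∧ ∀ i, m i • e i ∈ N := by
  obtain ⟨n, snf⟩ := N.smithNormalForm b
  refine ⟨snf.bM, Function.extend snf.f snf.a 0, fun s hs i => ?_, fun i => ?_⟩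
  · by_cases hi : i ∈ Set.range snf.f
    · obtain ⟨j, rfl⟩ := hi
      have := snf.repr_apply_embedding_eq_repr_smul ⟨s, hs⟩ (i := j)
      rw [snf.f.injective.extend_apply]
      exact ⟨_, this.trans (by rw [map_smul, Finsupp.smul_apply, smul_eq_mul])⟩
    · rw [snf.repr_eq_zero_of_notMem_range ⟨s, hs⟩ hi]
      exact dvd_zero _
  · by_cases hi : i ∈ Set.range snf.f
    · obtain ⟨j, rfl⟩ := hi
      rw [snf.f.injective.extend_apply, ← snf.snf]
      exact (snf.bN j).2
    · rw [Function.extend_apply' _ _ _ hi]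
      simp

/-- A finitely generated submodule of a free module over a principal ideal domain has a basis
consisting of multiples of members of a basis of the whole module. -/
theorem exists_basis_adapted {K X : Type*} [CommRing K] [IsDomain K] [IsPrincipalIdealRing K]
    (S : Set (X →₀ K)) (hS : S.Finite) :
    ∃ (e : Module.Basis X K (X →₀ K)) (m : X → K),
      (∀ s ∈ S, ∀ x, m x ∣ e.repr s x) ∧ ∀ x, m x • e x ∈ Submodule.span K S := by
  classical
  obtain ⟨Y, hY⟩ : ∃ Y : Finset X, ∀ s ∈ S, s ∈ Finsupp.supported K K (Y : Set X) := by
    refine ⟨hS.toFinset.biUnion Finsupp.support, fun s hs => ?_⟩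
    rw [Finsupp.mem_supported]
    exact fun x hx => Finset.mem_biUnion.2 ⟨s, by simpa using hs, hx⟩
  let p : X → Prop := fun x => x ∈ Y
  let E : (X →₀ K) ≃ₗ[K] ({x // p x} →₀ K) × ({x // ¬ p x} →₀ K) :=
    (Finsupp.domLCongr (Equiv.sumCompl p).symm).trans (Finsupp.sumFinsuppLEquivProdFinsupp K)
  have hE : ∀ s ∈ S, (E s).2 = 0 := by
    intro s hs
    ext ⟨x, hx⟩
    have := (Finsupp.mem_supported' K s).1 (hY s hs) x hx
    simpa [E] using this
  obtain ⟨b, m, h1, h2⟩ := exists_basis_adapted_of_finite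
    (Finsupp.basisSingleOne (R := K) (ι := {x // p x}))
    ((Submodule.span K S).comap (E.symm.toLinearMap ∘ₗ LinearMap.inl K _ _))
  have hb : ∀ v, E v = ((E v).1, 0) → ∀ x : {x // p x} ⊕ {x // ¬ p x},
      (b.prod (Finsupp.basisSingleOne (R := K) (ι := {x // ¬ p x}))).repr (E v) x =
        Sum.elim (b.repr (E v).1) 0 x := by
    intro v hv x
    rw [hv]
    rcases x with x | x <;> simp
  refine ⟨((b.prod (Finsupp.basisSingleOne (R := K) (ι := {x // ¬ p x}))).map E.symm).reindex
    (Equiv.sumCompl p), fun x => Sum.elim m 0 ((Equiv.sumCompl p).symm x), fun s hs x => ?_,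
    fun x => ?_⟩
  · have hs2 : E s = ((E s).1, 0) := Prod.ext rfl (hE s hs)
    have hs1 : (E s).1 ∈
        (Submodule.span K S).comap (E.symm.toLinearMap ∘ₗ LinearMap.inl K _ _) := by
      rw [Submodule.mem_comap]
      have : E.symm ((E s).1, 0) = s := by rw [← hs2, E.symm_apply_apply]
      simpa [this] using Submodule.subset_span hs
    rw [Module.Basis.repr_reindex, Finsupp.mapDomain_equiv_apply, Module.Basis.map_repr,
      LinearEquiv.trans_apply, LinearEquiv.symm_symm, hb s hs2]
    dsimp only
    rcases (Equiv.sumCompl p).symm x with x | x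
    · exact h1 _ hs1 x
    · simp
  · rw [Module.Basis.reindex_apply, Module.Basis.map_apply]
    dsimp only
    rcases (Equiv.sumCompl p).symm x with x | x
    · have := h2 x
      rw [Submodule.mem_comap, map_smul] at this
      simpa using this
    · simp

/-! ### Iterated brackets and the lower central series -/

section IterBracket

variable {K L : Type*} [CommRing K] [LieRing L] [LieAlgebra K L]

theorem gamma_succ_succ (k : ℕ) :
    gamma K L (k + 2) = ⁅(⊤ : LieIdeal K L), gamma K L (k + 1)⁆ :=
  LieModule.lowerCentralSeries_succ K L L k

theorem mem_gamma_one (x : L) : x ∈ gamma K L 1 := by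
  simp [gamma]

theorem lie_mem_iterBracket (R : LieIdeal K L) (k : ℕ) {x : L} (hx : x ∈ iterBracket R k)
    (y : L) : ⁅x, y⁆ ∈ iterBracket R (k + 1) :=
  LieSubmodule.lie_mem_lie hx (LieSubmodule.mem_top y)

theorem lie_mem_iterBracket_of_mem_gamma (R : LieIdeal K L) (k l : ℕ) {x y : L}
    (hx : x ∈ iterBracket R k) (hy : y ∈ gamma K L (l + 1)) :
    ⁅x, y⁆ ∈ iterBracket R (k + l + 1) := by
  induction l generalizing k x y with
  | zero => exact lie_mem_iterBracket R k hx y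
  | succ l ih =>
    rw [gamma_succ_succ, ← LieSubmodule.mem_toSubmodule,
      LieSubmodule.lieIdeal_oper_eq_linear_span'] at hy
    induction hy using Submodule.span_induction with
    | mem z hz =>
      obtain ⟨u, -, v, hv, rfl⟩ := hz
      rw [leibniz_lie]
      have h1 := ih (k + 1) (lie_mem_iterBracket R k hx u) hv
      have h2 := lie_mem_iterBracket R _ (ih k hx hv) u
      rw [← lie_skew] at h2
      have he : k + 1 + l + 1 = k + (l + 1) + 1 := by omega
      rw [he] at h1
      exact add_mem h1 (neg_mem_iff.1 h2)
    | zero => rw [lie_zero]; exact zero_mem _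
    | add a b _ _ ha hb => rw [lie_add]; exact add_mem ha hb
    | smul r a _ ha => rw [lie_smul]; exact SMulMemClass.smul_mem r ha

theorem iterBracket_top (k : ℕ) : iterBracket (⊤ : LieIdeal K L) k = gamma K L (k + 1) := by
  induction k with
  | zero => simp [gamma, iterBracket]
  | succ k ih => rw [gamma_succ_succ, iterBracket, ih, LieSubmodule.lie_comm]

theorem lie_mem_gamma (k l : ℕ) {x y : L} (hx : x ∈ gamma K L (k + 1))
    (hy : y ∈ gamma K L (l + 1)) : ⁅x, y⁆ ∈ gamma K L (k + l + 2) := by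
  rw [← iterBracket_top] at hx ⊢
  exact lie_mem_iterBracket_of_mem_gamma ⊤ k l hx hy

theorem eval_mem_gamma {X : Type*} (f : X → L) (t : Bracketing X) (k : ℕ)
    (ht : t.foliage.length = k + 1) : t.eval f ∈ gamma K L (k + 1) := by
  induction t generalizing k with
  | leaf x =>
    obtain rfl : k = 0 := by simpa [Bracketing.foliage] using ht.symm
    exact mem_gamma_one _
  | node a b iha ihb =>
    obtain ⟨i, hi⟩ := Nat.exists_eq_succ_of_ne_zero
      (List.length_pos_of_ne_nil a.foliage_ne_nil).ne'
    obtain ⟨j, hj⟩ := Nat.exists_eq_succ_of_ne_zero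
      (List.length_pos_of_ne_nil b.foliage_ne_nil).ne'
    obtain rfl : k = i + j + 1 := by
      simp only [Bracketing.foliage, List.length_append] at ht; omega
    exact lie_mem_gamma i j (iha i hi) (ihb j hj)

theorem lie_mem_iterBracket_sup_gamma (R : LieIdeal K L) (k l : ℕ) {x y : L}
    (hx : x ∈ iterBracket R k ⊔ gamma K L (k + 2)) (hy : y ∈ gamma K L (l + 1)) :
    ⁅x, y⁆ ∈ iterBracket R (k + l + 1) ⊔ gamma K L (k + l + 3) := by
  obtain ⟨r, hr, c, hc, rfl⟩ := (LieSubmodule.mem_sup _ _ _).1 hx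
  rw [add_lie]
  refine (LieSubmodule.mem_sup _ _ _).2
    ⟨_, lie_mem_iterBracket_of_mem_gamma R k l hr hy, _, ?_, rfl⟩
  have := lie_mem_gamma (k + 1) l hc hy
  rwa [show k + 1 + l + 2 = k + l + 3 by omega] at this

theorem smul_eval_mem {X : Type*} (f : X → L) (R : LieIdeal K L) {x : X} {m : K}
    (hm : m • f x ∈ R ⊔ gamma K L 2) (t : Bracketing X) (hx : x ∈ t.foliage) (k : ℕ)
    (ht : t.foliage.length = k + 1) :
    m • t.eval f ∈ iterBracket R k ⊔ gamma K L (k + 2) := by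
  induction t generalizing k with
  | leaf y =>
    obtain rfl : k = 0 := by simpa [Bracketing.foliage] using ht.symm
    obtain rfl : x = y := by simpa [Bracketing.foliage] using hx
    exact hm
  | node a b iha ihb =>
    obtain ⟨i, hi⟩ := Nat.exists_eq_succ_of_ne_zero
      (List.length_pos_of_ne_nil a.foliage_ne_nil).ne'
    obtain ⟨j, hj⟩ := Nat.exists_eq_succ_of_ne_zero
      (List.length_pos_of_ne_nil b.foliage_ne_nil).ne'
    obtain rfl : k = i + j + 1 := by
      simp only [Bracketing.foliage, List.length_append] at ht; omega
    rw [Bracketing.eval]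
    rcases List.mem_append.1 hx with hx | hx
    · rw [← smul_lie]
      exact lie_mem_iterBracket_sup_gamma R i j (iha hx i hi) (eval_mem_gamma f b j hj)
    · rw [← lie_smul, ← lie_skew, add_comm i j]
      exact neg_mem (lie_mem_iterBracket_sup_gamma R j i (ihb hx j hj) (eval_mem_gamma f a i hi))

end IterBracket

/-! ### Images in the enveloping algebra -/

section Enveloping

variable {K L : Type*} [CommRing K] [LieRing L] [LieAlgebra K L]

instance : (augmentationIdeal K L).IsTwoSided :=
  inferInstanceAs (TwoSidedIdeal.asIdeal _).IsTwoSided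

theorem ι_mem_augmentationIdeal (x : L) :
    UniversalEnvelopingAlgebra.ι K x ∈ augmentationIdeal K L :=
  TwoSidedIdeal.mem_asIdeal.2 (TwoSidedIdeal.subset_span ⟨x, rfl⟩)

theorem ι_mem_iterIdeal (R : LieIdeal K L) (k : ℕ) {x : L} (hx : x ∈ iterBracket R k) :
    UniversalEnvelopingAlgebra.ι K x ∈ iterIdeal R k := by
  induction k generalizing x with
  | zero => exact Ideal.subset_span ⟨x, hx, rfl⟩
  | succ k ih =>
    rw [iterBracket, ← LieSubmodule.mem_toSubmodule,
      LieSubmodule.lieIdeal_oper_eq_linear_span'] at hx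
    induction hx using Submodule.span_induction with
    | mem z hz =>
      obtain ⟨u, hu, v, -, rfl⟩ := hz
      rw [LieHom.map_lie, LieRing.of_associative_ring_bracket]
      exact sub_mem
        (Submodule.mem_sup_right (Ideal.mul_mem_mul (ih hu) (ι_mem_augmentationIdeal v)))
        (Submodule.mem_sup_left (Ideal.mul_mem_mul (ι_mem_augmentationIdeal v) (ih hu)))
    | zero => rw [map_zero]; exact zero_mem _
    | add a b _ _ ha hb => rw [map_add]; exact add_mem ha hb
    | smul r a _ ha => rw [map_smul, Algebra.smul_def]; exact Ideal.mul_mem_left _ _ ha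

theorem ι_mem_augmentationIdeal_pow (k : ℕ) {x : L} (hx : x ∈ gamma K L (k + 1)) :
    UniversalEnvelopingAlgebra.ι K x ∈ augmentationIdeal K L ^ (k + 1) := by
  induction k generalizing x with
  | zero => rw [zero_add, Submodule.pow_one]; exact ι_mem_augmentationIdeal x
  | succ k ih =>
    rw [gamma_succ_succ, ← LieSubmodule.mem_toSubmodule,
      LieSubmodule.lieIdeal_oper_eq_linear_span'] at hx
    induction hx using Submodule.span_induction with
    | mem z hz =>
      obtain ⟨u, -, v, hv, rfl⟩ := hz
      rw [LieHom.map_lie, LieRing.of_associative_ring_bracket]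
      refine sub_mem ?_ ?_
      · rw [Submodule.pow_succ' _ (Nat.succ_ne_zero k)]
        exact Ideal.mul_mem_mul (ι_mem_augmentationIdeal u) (ih hv)
      · rw [Submodule.pow_succ]
        exact Ideal.mul_mem_mul (ih hv) (ι_mem_augmentationIdeal u)
    | zero => rw [map_zero]; exact zero_mem _
    | add a b _ _ ha hb => rw [map_add]; exact add_mem ha hb
    | smul r a _ ha => rw [map_smul, Algebra.smul_def]; exact Ideal.mul_mem_left _ _ ha

end Enveloping

/-! ### Passing to the free associative algebra in an adapted basis -/

section Coordinates

variable {K X : Type*} [CommRing K]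

theorem toWords_mem_coeffsIn (y : FreeLieAlgebra K X) :
    toWords K X y ∈ coeffsIn (lengthGE K 1) := by
  let S : LieSubalgebra K (FreeLieAlgebra K X) :=
    { (coeffsIn (lengthGE K 1)).comap (toWords K X : FreeLieAlgebra K X →ₗ[K] _) with
      lie_mem' := by
        intro a b ha hb
        change toWords K X ⁅a, b⁆ ∈ coeffsIn (lengthGE K 1)
        rw [LieHom.map_lie, LieRing.of_associative_ring_bracket]
        have h : ∀ u v : List X, lengthGE K 1 u * lengthGE K 1 v ≤ lengthGE K 1 (u ++ v) := by
          intro u v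
          refine (lengthGE_mul_le 1 1 u v).trans ?_
          unfold lengthGE
          split_ifs <;> first | omega | simp
        exact sub_mem (mul_mem_coeffsIn h ha hb) (mul_mem_coeffsIn h hb ha) }
  have hS : S = ⊤ := lieSubalgebra_eq_top_of_of_mem S fun x => by
    change toWords K X _ ∈ coeffsIn (lengthGE K 1)
    rw [toWords, FreeLieAlgebra.lift_of_apply, ← one_smul K (word K [x])]
    exact word_mem_coeffsIn (by simp [lengthGE])
  have : y ∈ S := hS ▸ LieSubalgebra.mem_top y
  exact this

/-- The linear combinations of the generators of a free Lie algebra. -/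
noncomputable def lin : (X →₀ K) →ₗ[K] FreeLieAlgebra K X :=
  Finsupp.linearCombination K (FreeLieAlgebra.of K)

theorem exists_lin_sub_mem (y : FreeLieAlgebra K X) :
    ∃ v, y - lin v ∈ gamma K (FreeLieAlgebra K X) 2 := by
  let S : LieSubalgebra K (FreeLieAlgebra K X) :=
    { LinearMap.range lin ⊔ (gamma K (FreeLieAlgebra K X) 2).toSubmodule with
      lie_mem' := fun {a b} _ _ =>
        Submodule.mem_sup_right (lie_mem_gamma 0 0 (mem_gamma_one a) (mem_gamma_one b)) }
  have hS : S = ⊤ := lieSubalgebra_eq_top_of_of_mem S fun x =>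
    Submodule.mem_sup_left ⟨Finsupp.single x 1, by simp [lin]⟩
  have hy : y ∈ S := hS ▸ LieSubalgebra.mem_top y
  obtain ⟨_, ⟨v, rfl⟩, c, hc, rfl⟩ := Submodule.mem_sup.1 (show y ∈
    LinearMap.range lin ⊔ (gamma K (FreeLieAlgebra K X) 2).toSubmodule from hy)
  exact ⟨v, by simpa using hc⟩

/-- The substitution expressing the generators in the coordinates of another basis. -/
noncomputable def toBasis (e : Module.Basis X K (X →₀ K)) :
    FreeLieAlgebra K X →ₗ⁅K⁆ FreeLieAlgebra K X :=
  FreeLieAlgebra.lift K fun x => lin (e.repr (Finsupp.single x 1))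

/-- The substitution of the members of a basis for the generators. -/
noncomputable def ofBasis (e : Module.Basis X K (X →₀ K)) :
    FreeLieAlgebra K X →ₗ⁅K⁆ FreeLieAlgebra K X :=
  FreeLieAlgebra.lift K fun x => lin (e x)

theorem toBasis_lin (e : Module.Basis X K (X →₀ K)) (v : X →₀ K) :
    toBasis e (lin v) = lin (e.repr v) := by
  have : (toBasis e : FreeLieAlgebra K X →ₗ[K] _) ∘ₗ lin = lin ∘ₗ e.repr.toLinearMap := by
    ext x
    simp [toBasis, lin]
  exact LinearMap.congr_fun this v

theorem ofBasis_lin_repr (e : Module.Basis X K (X →₀ K)) (v : X →₀ K) :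
    ofBasis e (lin (e.repr v)) = lin v := by
  have : (ofBasis e : FreeLieAlgebra K X →ₗ[K] _) ∘ₗ lin ∘ₗ e.repr.toLinearMap = lin :=
    e.ext fun x => by simp [ofBasis, lin]
  exact LinearMap.congr_fun this v

theorem ofBasis_toBasis (e : Module.Basis X K (X →₀ K)) (y : FreeLieAlgebra K X) :
    ofBasis e (toBasis e y) = y := by
  have : (ofBasis e).comp (toBasis e) = LieHom.id := by
    ext x
    rw [LieHom.comp_apply, LieHom.id_apply, toBasis, FreeLieAlgebra.lift_of_apply,
      ofBasis_lin_repr]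
    simp [lin]
  exact LieHom.congr_fun this y

/-- The map from the enveloping algebra of the free Lie algebra to the free associative algebra in
the coordinates of a basis. -/
noncomputable def envelopingToWords (e : Module.Basis X K (X →₀ K)) :
    UniversalEnvelopingAlgebra K (FreeLieAlgebra K X) →ₐ[K] MonoidAlgebra K (FreeMonoid X) :=
  UniversalEnvelopingAlgebra.lift K ((toWords K X).comp (toBasis e))

variable (e : Module.Basis X K (X →₀ K))

theorem envelopingToWords_ι (y : FreeLieAlgebra K X) :
    envelopingToWords e (UniversalEnvelopingAlgebra.ι K y) = toWords K X (toBasis e y) :=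
  UniversalEnvelopingAlgebra.lift_ι_apply K _ y

theorem mem_coeffsIn_lengthGE_zero (a : MonoidAlgebra K (FreeMonoid X)) :
    a ∈ coeffsIn (lengthGE K 0) := fun w => by simp [lengthGE]

theorem envelopingToWords_mem_of_mem_augmentationIdeal
    {u : UniversalEnvelopingAlgebra K (FreeLieAlgebra K X)}
    (hu : u ∈ augmentationIdeal K (FreeLieAlgebra K X)) :
    envelopingToWords e u ∈ coeffsIn (lengthGE K 1) := by
  rw [augmentationIdeal, TwoSidedIdeal.mem_asIdeal] at hu
  induction hu using TwoSidedIdeal.span_induction with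
  | mem x hx =>
    obtain ⟨y, rfl⟩ := hx
    rw [envelopingToWords_ι]
    exact toWords_mem_coeffsIn _
  | zero => rw [map_zero]; exact zero_mem _
  | add x y _ _ hx hy => rw [map_add]; exact add_mem hx hy
  | neg x _ hx => rw [map_neg]; exact neg_mem hx
  | left_absorb a x _ hx =>
    rw [map_mul]
    exact mul_mem_coeffsIn (M := lengthGE K 0) (lengthGE_mul_le 0 1)
      (mem_coeffsIn_lengthGE_zero _) hx
  | right_absorb b x _ hx =>
    rw [map_mul]
    exact mul_mem_coeffsIn (M' := lengthGE K 0) (lengthGE_mul_le 1 0) hx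
      (mem_coeffsIn_lengthGE_zero _)

theorem envelopingToWords_mem_of_mem_augmentationIdeal_pow (k : ℕ)
    {u : UniversalEnvelopingAlgebra K (FreeLieAlgebra K X)}
    (hu : u ∈ augmentationIdeal K (FreeLieAlgebra K X) ^ k) :
    envelopingToWords e u ∈ coeffsIn (lengthGE K k) := by
  induction k generalizing u with
  | zero => exact mem_coeffsIn_lengthGE_zero _
  | succ k ih =>
    rw [Submodule.pow_succ] at hu
    refine Submodule.smul_induction_on hu (fun r hr s hs => ?_) (fun x y hx hy => ?_)
    · rw [smul_eq_mul, map_mul]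
      exact mul_mem_coeffsIn (lengthGE_mul_le k 1) (ih hr)
        (envelopingToWords_mem_of_mem_augmentationIdeal e hs)
    · rw [map_add]; exact add_mem hx hy

theorem toWords_lin_mem_coeffsIn (m : X → K) (v : X →₀ K) (hv : ∀ x, m x ∣ v x) :
    toWords K X (lin v) ∈ coeffsIn (modulus m 1) := by
  rw [lin, Finsupp.linearCombination_apply, Finsupp.sum, map_sum]
  refine sum_mem fun x _ => ?_
  rw [map_smul, toWords, FreeLieAlgebra.lift_of_apply]
  refine word_mem_coeffsIn ?_
  have : modulus m 1 [x] = Ideal.span {m x} := by simp [modulus]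
  rw [this]
  exact Ideal.mem_span_singleton.2 (hv x)

/-- Finitely many linear forms in `R + γ₂` force the image of `t` to satisfy the condition
`modulus m k`, for every basis in which these forms have coordinates divisible by `m`. -/
def FinitelyConstrained (R : LieIdeal K (FreeLieAlgebra K X)) (k : ℕ)
    (t : UniversalEnvelopingAlgebra K (FreeLieAlgebra K X)) : Prop :=
  ∃ S : Set (X →₀ K), S.Finite ∧ (∀ s ∈ S, lin s ∈ R ⊔ gamma K (FreeLieAlgebra K X) 2) ∧
    ∀ (e : Module.Basis X K (X →₀ K)) (m : X → K), (∀ s ∈ S, ∀ x, m x ∣ e.repr s x) →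
      envelopingToWords e t ∈ coeffsIn (modulus m k)

theorem FinitelyConstrained.add {R : LieIdeal K (FreeLieAlgebra K X)} {k : ℕ}
    {t t' : UniversalEnvelopingAlgebra K (FreeLieAlgebra K X)} (ht : FinitelyConstrained R k t)
    (ht' : FinitelyConstrained R k t') : FinitelyConstrained R k (t + t') := by
  obtain ⟨S, hS, hSR, h⟩ := ht
  obtain ⟨S', hS', hSR', h'⟩ := ht'
  refine ⟨S ∪ S', hS.union hS', fun s hs => hs.elim (hSR s) (hSR' s), fun e m hm => ?_⟩
  rw [map_add]
  exact add_mem (h e m fun s hs => hm s (Or.inl hs)) (h' e m fun s hs => hm s (Or.inr hs))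

theorem finitelyConstrained_of_mem_iterIdeal (R : LieIdeal K (FreeLieAlgebra K X)) (k : ℕ)
    {t : UniversalEnvelopingAlgebra K (FreeLieAlgebra K X)} (ht : t ∈ iterIdeal R k) :
    FinitelyConstrained R (k + 1) t := by
  induction k generalizing t with
  | zero =>
    induction ht using Submodule.span_induction with
    | mem x hx =>
      obtain ⟨r, hr, rfl⟩ := hx
      obtain ⟨v, hv⟩ := exists_lin_sub_mem r
      refine ⟨{v}, Set.finite_singleton v, ?_, fun e m hm => ?_⟩
      · rintro s rfl
        rw [← sub_sub_cancel r (lin s)]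
        exact sub_mem (LieSubmodule.mem_sup_left hr) (LieSubmodule.mem_sup_right hv)
      · rw [← sub_add_cancel r (lin v), map_add, map_add]
        refine add_mem ?_ ?_
        · exact coeffsIn_mono (lengthGE_le_modulus m 1)
            (envelopingToWords_mem_of_mem_augmentationIdeal_pow e 2
              (ι_mem_augmentationIdeal_pow 1 hv))
        · rw [envelopingToWords_ι, toBasis_lin]
          exact toWords_lin_mem_coeffsIn m _ (hm v rfl)
    | zero => exact ⟨∅, Set.finite_empty, by simp, fun e m _ => by rw [map_zero]; exact zero_mem _⟩
    | add a b _ _ ha hb => exact ha.add hb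
    | smul u a _ ha =>
      obtain ⟨S, hS, hSR, h⟩ := ha
      refine ⟨S, hS, hSR, fun e m hm => ?_⟩
      rw [smul_eq_mul, map_mul]
      have := mul_mem_coeffsIn (lengthGE_mul_modulus_le m 0 1)
        (mem_coeffsIn_lengthGE_zero (envelopingToWords e u)) (h e m hm)
      simpa using this
  | succ k ih =>
    obtain ⟨a, ha, b, hb, rfl⟩ := Submodule.mem_sup.1 ht
    refine FinitelyConstrained.add ?_ ?_
    · refine Submodule.smul_induction_on ha (fun r hr s hs => ?_)
        (fun _ _ hx hy => hx.add hy)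
      obtain ⟨S, hS, hSR, h⟩ := ih hs
      refine ⟨S, hS, hSR, fun e m hm => ?_⟩
      rw [smul_eq_mul, map_mul, add_comm (k + 1) 1]
      exact mul_mem_coeffsIn (lengthGE_mul_modulus_le m 1 (k + 1))
        (envelopingToWords_mem_of_mem_augmentationIdeal e hr) (h e m hm)
    · refine Submodule.smul_induction_on hb (fun r hr s hs => ?_)
        (fun _ _ hx hy => hx.add hy)
      obtain ⟨S, hS, hSR, h⟩ := ih hr
      refine ⟨S, hS, hSR, fun e m hm => ?_⟩
      rw [smul_eq_mul, map_mul]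
      exact mul_mem_coeffsIn (modulus_mul_lengthGE_le m (k + 1) 1) (h e m hm)
        (envelopingToWords_mem_of_mem_augmentationIdeal e hs)

end Coordinates

/-- The image, under a substitution, of the Lie elements whose Lyndon coordinates satisfy the
congruences given by `modulus m (n + 1)`. -/
theorem map_mem_of_mem_span_smul_eval {K L X : Type*} [CommRing K] [LieRing L] [LieAlgebra K L]
    [LinearOrder X] (R : LieIdeal K L) (n : ℕ) (m : X → K) (φ : FreeLieAlgebra K X →ₗ⁅K⁆ L)
    (hm : ∀ x, m x • φ (FreeLieAlgebra.of K x) ∈ R ⊔ gamma K L 2) {y : FreeLieAlgebra K X}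
    (hy : y ∈ Submodule.span K {z | ∃ t : Bracketing X, t.IsStandard ∧
      ∃ c ∈ modulus m (n + 1) t.foliage, z = c • t.eval (FreeLieAlgebra.of K)}) :
    φ y ∈ iterBracket R n ⊔ gamma K L (n + 2) := by
  induction hy using Submodule.span_induction with
  | mem z hz =>
    obtain ⟨t, -, c, hc, rfl⟩ := hz
    rw [map_smul, Bracketing.map_eval]
    rcases lt_trichotomy t.foliage.length (n + 1) with h | h | h
    · have : c = 0 := by simpa [modulus, h] using hc
      rw [this, zero_smul]
      exact zero_mem _
    · have hc' : c ∈ Ideal.span (m '' {y | y ∈ t.foliage}) := by simpa [modulus, h] using hc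
      clear hc
      induction hc' using Submodule.span_induction with
      | mem a ha =>
        obtain ⟨x, hx, rfl⟩ := ha
        exact smul_eval_mem (φ ∘ FreeLieAlgebra.of K) R (hm x) t hx n h
      | zero => rw [zero_smul]; exact zero_mem _
      | add a b _ _ ha hb => rw [add_smul]; exact add_mem ha hb
      | smul r a _ ha => rw [smul_assoc]; exact SMulMemClass.smul_mem r ha
    · obtain ⟨j, hj⟩ := Nat.exists_eq_add_of_le h
      have := eval_mem_gamma (K := K) (φ ∘ FreeLieAlgebra.of K) t (n + 1 + j) (by omega)
      have hmem : t.eval (φ ∘ FreeLieAlgebra.of K) ∈ gamma K L (n + 2) :=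
        LieModule.antitone_lowerCentralSeries K L L (by omega) this
      exact LieSubmodule.mem_sup_right (SMulMemClass.smul_mem c hmem)
  | zero => rw [map_zero]; exact zero_mem _
  | add a b _ _ ha hb => rw [map_add]; exact add_mem ha hb
  | smul r a _ ha => rw [map_smul]; exact SMulMemClass.smul_mem r ha

/-- The case of a free Lie algebra over a principal ideal domain. -/
theorem preimage_augmentationIdeal_pow_add_iterIdeal {K X : Type*} [CommRing K] [IsDomain K]
    [IsPrincipalIdealRing K] (R : LieIdeal K (FreeLieAlgebra K X)) (n : ℕ) :
    UniversalEnvelopingAlgebra.ι K ⁻¹'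
        ((augmentationIdeal K (FreeLieAlgebra K X) ^ (n + 2) + iterIdeal R n :
            Ideal (UniversalEnvelopingAlgebra K (FreeLieAlgebra K X))) :
          Set (UniversalEnvelopingAlgebra K (FreeLieAlgebra K X))) =
      ((gamma K (FreeLieAlgebra K X) (n + 2) ⊔ iterBracket R n :
          LieIdeal K (FreeLieAlgebra K X)) : Set (FreeLieAlgebra K X)) := by
  ext x
  simp only [Set.mem_preimage, SetLike.mem_coe, Submodule.add_eq_sup]
  constructor
  · intro hx
    obtain ⟨w, hw, t, ht, hwt⟩ := Submodule.mem_sup.1 hx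
    obtain ⟨S, hS, hSR, hSt⟩ := finitelyConstrained_of_mem_iterIdeal R n ht
    obtain ⟨e, m, hm, hmS⟩ := exists_basis_adapted S hS
    have hmR : ∀ y, m y • lin (e y) ∈ R ⊔ gamma K (FreeLieAlgebra K X) 2 := by
      intro y
      rw [← map_smul]
      refine Submodule.span_induction
        (p := fun v _ => lin v ∈ R ⊔ gamma K (FreeLieAlgebra K X) 2) hSR ?_ ?_ ?_ (hmS y)
      · rw [map_zero]; exact zero_mem _
      · intro a b _ _ ha hb; rw [map_add]; exact add_mem ha hb
      · intro r a _ ha; rw [map_smul]; exact SMulMemClass.smul_mem r ha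
    have hcoeff : toWords K X (toBasis e x) ∈ coeffsIn (modulus m (n + 1)) := by
      rw [← envelopingToWords_ι, ← hwt, map_add]
      exact add_mem (coeffsIn_mono (lengthGE_le_modulus m (n + 1))
        (envelopingToWords_mem_of_mem_augmentationIdeal_pow e (n + 2) hw)) (hSt e m hm)
    obtain ⟨_, -⟩ := exists_wellFoundedLT X
    have hspan := mem_span_smul_eval (modulus m (n + 1))
      (fun v w h => modulus_perm m (n + 1) h) (toBasis e x) hcoeff
    rw [sup_comm, ← ofBasis_toBasis e x]
    exact map_mem_of_mem_span_smul_eval R n m _ (fun y => by simpa [ofBasis] using hmR y) hspan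
  · intro hx
    obtain ⟨c, hc, r, hr, rfl⟩ := (LieSubmodule.mem_sup _ _ _).1 hx
    rw [map_add]
    exact add_mem (Submodule.mem_sup_left (ι_mem_augmentationIdeal_pow (n + 1) hc))
      (Submodule.mem_sup_right (ι_mem_iterIdeal R n hr))

end LieDimension

theorem mainTheorem11 {X : Type*} (R : LieIdeal ℤ (FreeLieAlgebra ℤ X)) (n : ℕ) (hn : 1 ≤ n) :
    UniversalEnvelopingAlgebra.ι ℤ ⁻¹'
        ((LieDimension.augmentationIdeal ℤ (FreeLieAlgebra ℤ X) ^ (n + 1) +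
          LieDimension.iterIdeal R (n - 1) :
            Ideal (UniversalEnvelopingAlgebra ℤ (FreeLieAlgebra ℤ X))) :
          Set (UniversalEnvelopingAlgebra ℤ (FreeLieAlgebra ℤ X))) =
      ((LieDimension.gamma ℤ (FreeLieAlgebra ℤ X) (n + 1) ⊔ LieDimension.iterBracket R (n - 1) :
          LieIdeal ℤ (FreeLieAlgebra ℤ X)) : Set (FreeLieAlgebra ℤ X)) := by
  obtain ⟨k, rfl⟩ := Nat.exists_eq_add_of_le' hn
  exact LieDimension.preimage_augmentationIdeal_pow_add_iterIdeal R k
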